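/- **Setting.** Let $N,K\ge 1$, $0\le\mu<1$, $P>0$, $T,\alpha_i\in\mathbb R$ (period $T$, time-switching ratio $\alpha_i$). For a fixed user $u_i$, let $x_k^{(m)},y_k^{(m)}$ ($1\le m\le N$, $0\le k\le K$) be independent standard real Gaussian variables. The channel gain from access point $m$ to port $k\in\{1,\dots,K\}$ of $u_i$ is $$g_k^{(m)}=\big(\sqrt{1-\mu^2}\,x_k^{(m)}+\mu x_0^{(m)}\big)+j\big(\sqrt{1-\mu^2}\,y_k^{(m)}+\mu y_0^{(m)}\big),$$ the power harvested at port $k$ is $Q_k=\sum_{m=1}^N P|g_k^{(m)}|^2$, the port $k^*\in\arg\max_k Q_k$ is activated, and the average harvested energy is $E_{avg}=(1-\alpha_i)T\,\mathbb E[Q_{k^*}]$. Put $$Y_k=\sum_{m=1}^N\Big[\Big(x_k^{(m)}+\tfrac{\mu}{\sqrt{1-\mu^2}}x_0^{(m)}\Big)^2+\Big(y_k^{(m)}+\tfrac{\mu}{\sqrt{1-\mu^2}}y_0^{(m)}\Big)^2\Big],\qquad Z=\max_{1\le k\le K}Y_k,$$ and $\psi_i=(1-\alpha_i)(1-\mu^2)TP$.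 For $b\ge 0$ and integers $M\ge 0$ let $Q_M(a,b)=\int_b^\infty x\,(x/a)^{M-1}e^{-(x^2+a^2)/2}I_{M-1}(ax)\,dx$ ($a>0$), $Q_M(0,b)=e^{-b^2/2}\sum_{j<M}\frac{(b^2/2)^j}{j!}$ be the Marcum Q-function, where $I_n$ is the modified Bessel function of the first kind ($I_{-1}=I_1$). **Theorem.** The variables $Q_{k^*}$ and $Z$ are integrable and $E_{avg}=\psi_i\,\mathbb E[Z]$. For $z\ge 0$, $$\Pr(Z<z)=\int_0^\infty\frac{r^{N-1}e^{-r/2}}{2^N\Gamma(N)}\Big[1-Q_N\Big(\sqrt{\tfrac{\mu^2r}{1-\mu^2}},\sqrt z\Big)\Big]^K dr .$$ For $z>0$ this integral may be differentiated in $z$ under the integral sign, with derivative $$f_Z(z)=K\int_0^\infty\frac{r^{N-1}e^{-r/2}}{2^{N+1}\Gamma(N)}\Big[1-Q_N\Big(\sqrt{\tfrac{\mu^2r}{1-\mu^2}},\sqrt z\Big)\Big]^{K-1}\Big[Q_N\Big(\sqrt{\tfrac{\mu^2r}{1-\mu^2}},\sqrt z\Big)-Q_{N-1}\Big(\sqrt{\tfrac{\mu^2r}{1-\mu^2}},\sqrt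 z\Big)\Big]dr,$$ $f_Z$ is a density of $Z$ on $(0,\infty)$, and, all the integrals converging, $$E_{avg}=\psi_i\int_0^\infty t f_Z(t)\,dt=\psi_i\int_0^\infty Kt\int_0^\infty\frac{r^{N-1}e^{-r/2}}{2^{N+1}\Gamma(N)}\Big[1-Q_N\Big(\sqrt{\tfrac{\mu^2r}{1-\mu^2}},\sqrt t\Big)\Big]^{K-1}\Big[Q_N\Big(\sqrt{\tfrac{\mu^2r}{1-\mu^2}},\sqrt t\Big)-Q_{N-1}\Big(\sqrt{\tfrac{\mu^2r}{1-\mu^2}},\sqrt t\Big)\Big]dr\,dt .$$ -/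

import Mathlib

open MeasureTheory ProbabilityTheory Set

/-- Modified Bessel function of the first kind of integer order `n`,
`I_n(z) = ∑ j, (z/2)^(2j+|n|) / (j! (j+|n|)!)`; recall that `I_{-n} = I_n` for integers `n`. -/
noncomputable def besselI (n : ℤ) (z : ℝ) : ℝ :=
  ∑' j : ℕ, (z / 2) ^ (2 * j + n.natAbs) / ((j.factorial : ℝ) * ((j + n.natAbs).factorial : ℝ))

/-- Marcum Q-function of order `M` for `a, b ≥ 0`:
`Q_M(a, b) = ∫_b^∞ x (x/a)^(M-1) exp(-(x²+a²)/2) I_{M-1}(a x) dx` for `a > 0`, and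
`Q_M(0, b) = exp(-b²/2) ∑_{j<M} (b²/2)^j / j!` (the limit as `a → 0`).
For the order `M = 0` the kernel is `I_{-1} = I_1`. -/
noncomputable def marcumQ (M : ℕ) (a b : ℝ) : ℝ :=
  if a = 0 then
    Real.exp (-b ^ 2 / 2) * ∑ j ∈ Finset.range M, (b ^ 2 / 2) ^ j / (j.factorial : ℝ)
  else
    ∫ x in Ioi b, x * (x / a) ^ ((M : ℤ) - 1) * Real.exp (-(x ^ 2 + a ^ 2) / 2) *
      besselI ((M : ℤ) - 1) (a * x)

/-- Channel gain from one access point to port `k`; index `0` of `x` and `y` is the component that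
is common to all the ports, and port `k` has its own components at index `k + 1`. -/
noncomputable def channelGain {Ω : Type*} {K : ℕ} (μ : ℝ) (x y : Fin (K + 1) → Ω → ℝ)
    (k : Fin K) (ω : Ω) : ℂ :=
  ((Real.sqrt (1 - μ ^ 2) * x k.succ ω + μ * x 0 ω : ℝ) : ℂ) +
    Complex.I * ((Real.sqrt (1 - μ ^ 2) * y k.succ ω + μ * y 0 ω : ℝ) : ℂ)

/-- Power harvested at port `k` from `N` access points with transmission powers `P m`. -/
noncomputable def harvestPower {Ω : Type*} {N K : ℕ} (P : Fin N → ℝ) (μ : ℝ)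
    (x y : Fin N → Fin (K + 1) → Ω → ℝ) (k : Fin K) (ω : Ω) : ℝ :=
  ∑ m, P m * ‖channelGain μ (x m) (y m) k ω‖ ^ 2

/-- The normalized power `Y_k` at port `k`. -/
noncomputable def normalizedPower {Ω : Type*} {N K : ℕ} (μ : ℝ)
    (x y : Fin N → Fin (K + 1) → Ω → ℝ) (k : Fin K) (ω : Ω) : ℝ :=
  ∑ m, ((x m k.succ ω + μ / Real.sqrt (1 - μ ^ 2) * x m 0 ω) ^ 2 +
    (y m k.succ ω + μ / Real.sqrt (1 - μ ^ 2) * y m 0 ω) ^ 2)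

/-- `Z = max_k Y_k`. -/
noncomputable def maxNormalizedPower {Ω : Type*} {N K : ℕ} (μ : ℝ)
    (x y : Fin N → Fin (K + 1) → Ω → ℝ) (ω : Ω) : ℝ :=
  ⨆ k : Fin K, normalizedPower μ x y k ω

/-- Average harvested energy in the energy slot, of length `(1 - α) T`, when port `kstar ω` is
activated. -/
noncomputable def avgHarvestedEnergy {Ω : Type*} [MeasurableSpace Ω] (ρ : Measure Ω) {N K : ℕ}
    (α T : ℝ) (P : Fin N → ℝ) (μ : ℝ) (x y : Fin N → Fin (K + 1) → Ω → ℝ) (kstar : Ω → Fin K) : ℝ :=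
  (1 - α) * T * ∫ ω, harvestPower P μ x y (kstar ω) ω ∂ρ

/-- Integrand (in `r`) of the outage probability at the normalized threshold `z`. -/
noncomputable def outageIntegrand (N K : ℕ) (μ z r : ℝ) : ℝ :=
  r ^ (N - 1) * Real.exp (-r / 2) / (2 ^ N * Real.Gamma N) *
    (1 - marcumQ N (Real.sqrt (μ ^ 2 * r / (1 - μ ^ 2))) (Real.sqrt z)) ^ K

/-- Integrand (in `r`) of the density of `Z` at `t`, without the factor `K`. -/
noncomputable def densityIntegrand (N K : ℕ) (μ t r : ℝ) : ℝ :=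
  r ^ (N - 1) * Real.exp (-r / 2) / (2 ^ (N + 1) * Real.Gamma N) *
    (1 - marcumQ N (Real.sqrt (μ ^ 2 * r / (1 - μ ^ 2))) (Real.sqrt t)) ^ (K - 1) *
    (marcumQ N (Real.sqrt (μ ^ 2 * r / (1 - μ ^ 2))) (Real.sqrt t) -
      marcumQ (N - 1) (Real.sqrt (μ ^ 2 * r / (1 - μ ^ 2))) (Real.sqrt t))

/-- The density `f_Z` on `(0, ∞)`. -/
noncomputable def maxDensity (N K : ℕ) (μ t : ℝ) : ℝ :=
  K * ∫ r in Ioi (0 : ℝ), densityIntegrand N K μ t r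

/-! Each port power is `P * (1 - μ ^ 2)` times `Y_k`, so the activated port harvests `P * (1 - μ ^
2) * Z` and everything reduces to the law of `Z`. Condition on the components common to all ports, a
Gaussian vector `u` in dimension `2N`. Given `u`, the `Y_k` are independent squared norms of shifted
Gaussian vectors, hence noncentral chi-squared with noncentrality `μ² r / (1 - μ²)`, `r = ‖u‖²`.
Their common distribution function is `1 - Q_N`; the maximum gives its `K`-th power, and averaging
over the chi-squared law of `r` gives the outage integral (`measureReal_maxNormalizedPower_lt`).

The analysis rests on writing `Q_M(√(2l), √(2s))` as a Poisson(`l`) mixture of the probabilities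
that a Poisson(`s`) variable is below `M + j` (`marcumQ_eq_marcumSeries`). Termwise, the
`s`-derivative is minus a mixture of single Poisson weights, which for `M ≥ 1` is `-(Q_M -
Q_{M-1})`: hence the difference of consecutive orders in the density. The same mixture defines the
noncentral chi-squared law, identified with the Gaussian one by characteristic functions
(`map_sum_add_sq_pi_gaussianReal`).

Domination by the Gamma density of `r` allows differentiation under the integral, and
`map_eq_withDensity_of_measureReal_lt` turns the derivative into a density. Convergence of `∫ t
f_Z(t) dt` is then read off from the integrability of `Z`. -/

open Filter Topology

/-! ### Poisson weights and their partial sums -/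

/-- The Poisson weight `exp (-u) u ^ k / k!`. -/
noncomputable def poissonWeight (k : ℕ) (u : ℝ) : ℝ :=
  Real.exp (-u) * u ^ k / (k.factorial : ℝ)

lemma poissonWeight_nonneg (k : ℕ) {u : ℝ} (hu : 0 ≤ u) : 0 ≤ poissonWeight k u := by
  unfold poissonWeight; positivity

lemma hasSum_poissonWeight (u : ℝ) : HasSum (fun k => poissonWeight k u) 1 := by
  have h := (NormedSpace.expSeries_div_hasSum_exp (𝔸 := ℝ) u).mul_left (Real.exp (-u))
  rw [← Real.exp_eq_exp_ℝ, ← Real.exp_add, neg_add_cancel, Real.exp_zero] at h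
  simpa only [poissonWeight, mul_div_assoc] using h

lemma summable_poissonWeight (u : ℝ) : Summable fun k => poissonWeight k u :=
  (hasSum_poissonWeight u).summable

lemma poissonWeight_le_one (k : ℕ) {u : ℝ} (hu : 0 ≤ u) : poissonWeight k u ≤ 1 :=
  le_hasSum (hasSum_poissonWeight u) k fun j _ => poissonWeight_nonneg j hu

lemma poissonWeight_zero_left (u : ℝ) : poissonWeight 0 u = Real.exp (-u) := by
  simp [poissonWeight]

lemma poissonWeight_succ_zero (k : ℕ) : poissonWeight (k + 1) 0 = 0 := by
  simp [poissonWeight]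

@[fun_prop]
lemma continuous_poissonWeight (k : ℕ) : Continuous (poissonWeight k) := by
  unfold poissonWeight; fun_prop

lemma hasDerivAt_poissonWeight_zero (u : ℝ) :
    HasDerivAt (poissonWeight 0) (-poissonWeight 0 u) u := by
  have h := (hasDerivAt_neg u).exp
  rw [mul_neg, mul_one] at h
  rw [show poissonWeight 0 = fun u => Real.exp (-u) from funext poissonWeight_zero_left]
  exact h

lemma hasDerivAt_poissonWeight_succ (k : ℕ) (u : ℝ) :
    HasDerivAt (poissonWeight (k + 1)) (poissonWeight k u - poissonWeight (k + 1) u) u := by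
  have h := (((hasDerivAt_neg u).exp).mul (hasDerivAt_pow (k + 1) u)).div_const
    ((k + 1).factorial : ℝ)
  convert! h using 1
  simp only [poissonWeight, Nat.factorial_succ]
  push_cast
  have h1 : ((k : ℝ) + 1) ≠ 0 := by positivity
  have h2 : (k.factorial : ℝ) ≠ 0 := by positivity
  field_simp
  ring

lemma tendsto_poissonWeight_atTop (k : ℕ) : Tendsto (poissonWeight k) atTop (𝓝 0) := by
  have h := (Real.tendsto_pow_mul_exp_neg_atTop_nhds_zero k).div_const (k.factorial : ℝ)
  rw [zero_div] at h
  exact h.congr fun u => by rw [poissonWeight, mul_comm]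

/-- The probability that a Poisson variable of parameter `u` is less than `n`. -/
noncomputable def poissonLT (n : ℕ) (u : ℝ) : ℝ := ∑ k ∈ Finset.range n, poissonWeight k u

/-- Minus the derivative of `poissonLT n`. -/
noncomputable def poissonPred : ℕ → ℝ → ℝ
  | 0, _ => 0
  | n + 1, u => poissonWeight n u

lemma poissonLT_nonneg (n : ℕ) {u : ℝ} (hu : 0 ≤ u) : 0 ≤ poissonLT n u :=
  Finset.sum_nonneg fun k _ => poissonWeight_nonneg k hu

lemma poissonLT_le_one (n : ℕ) {u : ℝ} (hu : 0 ≤ u) : poissonLT n u ≤ 1 :=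
  sum_le_hasSum _ (fun k _ => poissonWeight_nonneg k hu) (hasSum_poissonWeight u)

lemma poissonLT_succ (n : ℕ) (u : ℝ) :
    poissonLT (n + 1) u = poissonLT n u + poissonWeight n u :=
  Finset.sum_range_succ _ _

lemma poissonLT_succ_zero (n : ℕ) : poissonLT (n + 1) 0 = 1 := by
  simp [poissonLT, Finset.sum_range_succ', poissonWeight_succ_zero, poissonWeight_zero_left]

@[fun_prop]
lemma continuous_poissonLT (n : ℕ) : Continuous (poissonLT n) := by
  unfold poissonLT; fun_prop

lemma tendsto_poissonLT_atTop (n : ℕ) : Tendsto (poissonLT n) atTop (𝓝 0) := by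
  have := tendsto_finsetSum (Finset.range n) fun k _ => tendsto_poissonWeight_atTop k
  rw [Finset.sum_const_zero] at this
  exact this

/-- The derivatives of the individual weights telescope, leaving only the last weight. -/
lemma hasDerivAt_poissonLT (n : ℕ) (u : ℝ) :
    HasDerivAt (poissonLT n) (-poissonPred n u) u := by
  induction n with
  | zero =>
    have : poissonLT 0 = fun _ => 0 := by ext; simp [poissonLT]
    simpa [this, poissonPred] using hasDerivAt_const u (0 : ℝ)
  | succ n ih =>
    have e : poissonLT (n + 1) = fun v => poissonLT n v + poissonWeight n v :=
      funext (poissonLT_succ n)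
    rw [e]
    cases n with
    | zero =>
      convert! ih.add (hasDerivAt_poissonWeight_zero u) using 1
      simp [poissonPred]
    | succ n =>
      convert! ih.add (hasDerivAt_poissonWeight_succ n u) using 1
      simp only [poissonPred]
      ring

lemma poissonPred_nonneg (n : ℕ) {u : ℝ} (hu : 0 ≤ u) : 0 ≤ poissonPred n u := by
  cases n with
  | zero => exact le_rfl
  | succ n => exact poissonWeight_nonneg n hu

lemma poissonPred_le_one (n : ℕ) {u : ℝ} (hu : 0 ≤ u) : poissonPred n u ≤ 1 := by
  cases n with
  | zero => exact zero_le_one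
  | succ n => exact poissonWeight_le_one n hu

/-! ### Poisson mixtures -/

/-- `Q_M(√(2l), √(2s))` as a Poisson mixture. -/
noncomputable def marcumSeries (M : ℕ) (l s : ℝ) : ℝ :=
  ∑' j : ℕ, poissonWeight j l * poissonLT (M + j) s

/-- Minus the derivative of `marcumSeries M l`. -/
noncomputable def marcumKernel (M : ℕ) (l s : ℝ) : ℝ :=
  ∑' j : ℕ, poissonWeight j l * poissonPred (M + j) s

section Mixture

variable {l s : ℝ}

lemma norm_poissonWeight_mul_le (hl : 0 ≤ l) {c : ℝ} (h0 : 0 ≤ c) (h1 : c ≤ 1) (j : ℕ) :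
    ‖poissonWeight j l * c‖ ≤ poissonWeight j l := by
  have := poissonWeight_nonneg j hl
  rw [Real.norm_of_nonneg (by positivity)]
  exact mul_le_of_le_one_right this h1

lemma summable_poissonWeight_mul (hl : 0 ≤ l) {c : ℕ → ℝ} (h0 : ∀ j, 0 ≤ c j)
    (h1 : ∀ j, c j ≤ 1) : Summable fun j => poissonWeight j l * c j :=
  Summable.of_norm_bounded (summable_poissonWeight l)
    fun j => norm_poissonWeight_mul_le hl (h0 j) (h1 j) j

lemma tsum_poissonWeight_mul_le_one (hl : 0 ≤ l) {c : ℕ → ℝ} (h0 : ∀ j, 0 ≤ c j)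
    (h1 : ∀ j, c j ≤ 1) : ∑' j, poissonWeight j l * c j ≤ 1 := by
  rw [← (hasSum_poissonWeight l).tsum_eq]
  exact (summable_poissonWeight_mul hl h0 h1).tsum_le_tsum
    (fun j => mul_le_of_le_one_right (poissonWeight_nonneg j hl) (h1 j)) (summable_poissonWeight l)

lemma summable_marcumSeries (M : ℕ) (hl : 0 ≤ l) (hs : 0 ≤ s) :
    Summable fun j => poissonWeight j l * poissonLT (M + j) s :=
  summable_poissonWeight_mul hl (fun _ => poissonLT_nonneg _ hs) fun _ => poissonLT_le_one _ hs

lemma summable_marcumKernel (M : ℕ) (hl : 0 ≤ l) (hs : 0 ≤ s) :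
    Summable fun j => poissonWeight j l * poissonPred (M + j) s :=
  summable_poissonWeight_mul hl (fun _ => poissonPred_nonneg _ hs) fun _ => poissonPred_le_one _ hs

lemma marcumSeries_nonneg (M : ℕ) (hl : 0 ≤ l) (hs : 0 ≤ s) : 0 ≤ marcumSeries M l s :=
  tsum_nonneg fun j => mul_nonneg (poissonWeight_nonneg j hl) (poissonLT_nonneg _ hs)

lemma marcumSeries_le_one (M : ℕ) (hl : 0 ≤ l) (hs : 0 ≤ s) : marcumSeries M l s ≤ 1 :=
  tsum_poissonWeight_mul_le_one hl (fun _ => poissonLT_nonneg _ hs) fun _ => poissonLT_le_one _ hs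

lemma marcumKernel_nonneg (M : ℕ) (hl : 0 ≤ l) (hs : 0 ≤ s) : 0 ≤ marcumKernel M l s :=
  tsum_nonneg fun j => mul_nonneg (poissonWeight_nonneg j hl) (poissonPred_nonneg _ hs)

lemma marcumKernel_le_one (M : ℕ) (hl : 0 ≤ l) (hs : 0 ≤ s) : marcumKernel M l s ≤ 1 :=
  tsum_poissonWeight_mul_le_one hl (fun _ => poissonPred_nonneg _ hs)
    fun _ => poissonPred_le_one _ hs

/-- Positive order is essential: for order `0` the term `j = 0` vanishes and the value would be `1 -
exp (-l)`. This is what gives the chi-squared law total mass one. -/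
lemma marcumSeries_succ_zero (n : ℕ) (l : ℝ) : marcumSeries (n + 1) l 0 = 1 := by
  simp only [marcumSeries, add_right_comm n 1, poissonLT_succ_zero, mul_one]
  exact (hasSum_poissonWeight l).tsum_eq

/-- The difference of consecutive orders is the kernel of the larger one. -/
lemma marcumSeries_succ_sub (n : ℕ) (hl : 0 ≤ l) (hs : 0 ≤ s) :
    marcumSeries (n + 1) l s - marcumSeries n l s = marcumKernel (n + 1) l s := by
  rw [marcumSeries, marcumSeries, marcumKernel,
    ← (summable_marcumSeries _ hl hs).tsum_sub (summable_marcumSeries _ hl hs)]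
  refine tsum_congr fun j => ?_
  rw [add_right_comm, poissonLT_succ, poissonPred]
  ring

/-- Termwise differentiation on `(0, ∞)`, where the derivative of the `j`-th term is bounded by the
summable weight `poissonWeight j l`, uniformly in `s`. -/
lemma hasDerivAt_marcumSeries (M : ℕ) (hl : 0 ≤ l) (hs : 0 < s) :
    HasDerivAt (marcumSeries M l) (-marcumKernel M l s) s := by
  rw [marcumKernel, ← tsum_neg]
  refine hasDerivAt_tsum_of_isPreconnected (summable_poissonWeight l) isOpen_Ioi
    isPreconnected_Ioi (t := Ioi (0 : ℝ)) (y₀ := s)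
    (g := fun j u => poissonWeight j l * poissonLT (M + j) u)
    (g' := fun j u => -(poissonWeight j l * poissonPred (M + j) u)) (fun j u _ => ?_)
    (fun j u hu => ?_) hs
    (summable_marcumSeries M hl hs.le) hs
  · rw [← mul_neg]
    exact (hasDerivAt_poissonLT (M + j) u).const_mul (poissonWeight j l)
  · rw [norm_neg]
    exact norm_poissonWeight_mul_le hl (poissonPred_nonneg _ (le_of_lt hu))
      (poissonPred_le_one _ (le_of_lt hu)) j

lemma continuousOn_marcumSeries (M : ℕ) (hl : 0 ≤ l) :
    ContinuousOn (marcumSeries M l) (Ici 0) :=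
  continuousOn_tsum (fun j => by fun_prop) (summable_poissonWeight l) fun j u hu =>
    norm_poissonWeight_mul_le hl (poissonLT_nonneg _ hu) (poissonLT_le_one _ hu) j

lemma tendsto_marcumSeries_atTop (M : ℕ) (hl : 0 ≤ l) :
    Tendsto (marcumSeries M l) atTop (𝓝 0) := by
  have h := tendsto_tsum_of_dominated_convergence (𝓕 := atTop)
    (f := fun s j => poissonWeight j l * poissonLT (M + j) s) (g := fun _ => 0)
    (summable_poissonWeight l)
    (fun j => by simpa using (tendsto_poissonLT_atTop (M + j)).const_mul (poissonWeight j l))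
    (by
      filter_upwards [eventually_ge_atTop 0] with u hu j
      exact norm_poissonWeight_mul_le hl (poissonLT_nonneg _ hu) (poissonLT_le_one _ hu) j)
  rw [tsum_zero] at h
  exact h

end Mixture

/-! ### The Marcum Q-function as a Poisson mixture -/

section Marcum

/-- The integrand of the Marcum Q-function is a Poisson mixture. -/
lemma marcumQ_integrand_eq (M : ℕ) {a x : ℝ} (ha : 0 < a) (hx : 0 < x) :
    x * (x / a) ^ ((M : ℤ) - 1) * Real.exp (-(x ^ 2 + a ^ 2) / 2) * besselI ((M : ℤ) - 1) (a * x) =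
      x * marcumKernel M (a ^ 2 / 2) (x ^ 2 / 2) := by
  have hexp : Real.exp (-(x ^ 2 + a ^ 2) / 2) = Real.exp (-(a ^ 2 / 2)) * Real.exp (-(x ^ 2 / 2)) := by
    rw [← Real.exp_add]; ring_nf
  rw [hexp]
  cases M with
  | zero =>
    have hk := summable_marcumKernel 0 (l := a ^ 2 / 2) (s := x ^ 2 / 2) (by positivity)
      (by positivity)
    have e : (((0 : ℕ) : ℤ) - 1).natAbs = 1 := rfl
    -- The term `j = 0` of the order-zero kernel vanishes; shifting the index by one matches the
    -- series of `I_{-1} = I_1`.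
    rw [marcumKernel, hk.tsum_eq_zero_add, besselI, e, ← tsum_mul_left]
    have hp : ∀ j, poissonPred (0 + (j + 1)) (x ^ 2 / 2) = poissonWeight j (x ^ 2 / 2) :=
      fun j => by rw [zero_add, poissonPred]
    simp only [hp]
    simp only [poissonPred, mul_zero, zero_add]
    rw [← tsum_mul_left]
    refine tsum_congr fun j => ?_
    have e2 : (((0 : ℕ) : ℤ) - 1) = -1 := rfl
    simp only [e2, zpow_neg_one, poissonWeight]
    have h1 : (j.factorial : ℝ) ≠ 0 := by positivity
    have h2 : ((j + 1).factorial : ℝ) ≠ 0 := by positivity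
    field_simp
    ring
  | succ n =>
    have e : (((n + 1 : ℕ) : ℤ) - 1) = (n : ℤ) := by push_cast; ring
    rw [e, marcumKernel, besselI, Int.natAbs_natCast, zpow_natCast, ← tsum_mul_left, ← tsum_mul_left]
    refine tsum_congr fun j => ?_
    rw [add_right_comm, poissonPred, poissonWeight, poissonWeight, add_comm n j, div_pow]
    have h1 : (j.factorial : ℝ) ≠ 0 := by positivity
    have h2 : ((j + n).factorial : ℝ) ≠ 0 := by positivity
    field_simp
    ring

/-- For `a > 0` the integrand is the derivative of `-marcumSeries` at `x ^ 2 / 2`, which tends to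
`0` at infinity; its nonnegativity supplies integrability. For `a = 0` only the Poisson weight `j =
0` survives. -/
lemma marcumQ_eq_marcumSeries (M : ℕ) {a b : ℝ} (ha : 0 ≤ a) (hb : 0 ≤ b) :
    marcumQ M a b = marcumSeries M (a ^ 2 / 2) (b ^ 2 / 2) := by
  rcases ha.eq_or_lt with rfl | ha
  · rw [marcumQ, if_pos rfl, marcumSeries, tsum_eq_single 0]
    · simp only [poissonLT, poissonWeight, Finset.mul_sum]
      simp [mul_div_assoc, neg_div]
    · intro j hj
      obtain ⟨j, rfl⟩ := Nat.exists_eq_succ_of_ne_zero hj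
      simp [poissonWeight_succ_zero]
  · have hl : 0 ≤ a ^ 2 / 2 := by positivity
    rw [marcumQ, if_neg ha.ne', setIntegral_congr_fun measurableSet_Ioi
      (fun x hx => marcumQ_integrand_eq M ha (hb.trans_lt hx))]
    have hsq : ContinuousOn (fun x : ℝ => x ^ 2 / 2) (Ici b) := by fun_prop
    have hcont : ContinuousWithinAt (fun x => -marcumSeries M (a ^ 2 / 2) (x ^ 2 / 2)) (Ici b) b :=
      (((continuousOn_marcumSeries M hl).comp hsq fun x _ => by
        simp only [mem_Ici]; positivity).neg) b self_mem_Ici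
    have hderiv : ∀ x ∈ Ioi b, HasDerivAt (fun x => -marcumSeries M (a ^ 2 / 2) (x ^ 2 / 2))
        (x * marcumKernel M (a ^ 2 / 2) (x ^ 2 / 2)) x := by
      intro x hx
      have hx0 : 0 < x := hb.trans_lt hx
      have h2 : HasDerivAt (fun x : ℝ => x ^ 2 / 2) x x := by
        simpa using (hasDerivAt_pow 2 x).div_const 2
      have := ((hasDerivAt_marcumSeries M hl (s := x ^ 2 / 2) (by positivity)).comp x h2).neg
      convert! this using 1
      ring
    have hlim : Tendsto (fun x => -marcumSeries M (a ^ 2 / 2) (x ^ 2 / 2)) atTop (𝓝 0) := by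
      have h2 : Tendsto (fun x : ℝ => x ^ 2 / 2) atTop atTop :=
        (tendsto_pow_atTop two_ne_zero).atTop_div_const two_pos
      simpa using ((tendsto_marcumSeries_atTop M hl).comp h2).neg
    rw [integral_Ioi_of_hasDerivAt_of_nonneg hcont hderiv (fun x hx => ?_) hlim]
    · ring
    · exact mul_nonneg (hb.trans (le_of_lt hx)) (marcumKernel_nonneg M hl (by positivity))

end Marcum

/-! ### The noncentral chi-squared law -/

/-- A measure on `(0, ∞)` whose density is the derivative of `G` gives `[a, b)` the mass
`G b - G a`. -/
lemma withDensity_deriv_Ico {G g : ℝ → ℝ} (hG : ContinuousOn G (Ici 0))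
    (hderiv : ∀ t, 0 < t → HasDerivAt G (g t) t) (hg : ∀ t, 0 < t → 0 ≤ g t) {a b : ℝ}
    (ha : 0 ≤ a) (hab : a ≤ b) :
    (volume.restrict (Ioi (0 : ℝ))).withDensity (fun t => ENNReal.ofReal (g t)) (Ico a b) =
      ENNReal.ofReal (G b - G a) := by
  have hc : ContinuousOn G (Icc a b) := hG.mono fun t ht => ha.trans ht.1
  have hd : ∀ t ∈ Ioo a b, HasDerivAt G (g t) t := fun t ht => hderiv t (ha.trans_lt ht.1)
  have hi : IntegrableOn g (Ioc a b) :=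
    intervalIntegral.integrableOn_deriv_of_nonneg hc hd fun t ht => hg t (ha.trans_lt ht.1)
  have hae : (Ico a b ∩ Ioi 0 : Set ℝ) =ᵐ[volume] Ioc a b := by
    have h1 : (Ico a b ∩ Ioi 0 : Set ℝ) =ᵐ[volume] (Ico a b ∩ Ici 0 : Set ℝ) :=
      (ae_eq_refl _).inter Ioi_ae_eq_Ici
    have h2 : Ico a b ∩ Ici 0 = Ico a b := inter_eq_left.2 fun t ht => ha.trans ht.1
    rw [h2] at h1
    exact h1.trans Ico_ae_eq_Ioc
  rw [withDensity_apply _ measurableSet_Ico, Measure.restrict_restrict measurableSet_Ico,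
    Measure.restrict_congr_set hae, ← ofReal_integral_eq_lintegral_ofReal hi,
    ← intervalIntegral.integral_of_le hab, intervalIntegral.integral_eq_sub_of_hasDerivAt_of_le hab
      hc hd ((intervalIntegrable_iff_integrableOn_Ioc_of_le hab).2 hi)]
  exact ae_restrict_of_forall_mem measurableSet_Ioc fun t ht => hg t (ha.trans_lt ht.1)

/-- The noncentral chi-squared distribution with `2 * N` degrees of freedom and noncentrality
parameter `2 * l`. -/
noncomputable def noncentralChiSq (N : ℕ) (l : ℝ) : Measure ℝ :=
  (volume.restrict (Ioi (0 : ℝ))).withDensity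
    (fun s => ENNReal.ofReal (marcumKernel N l (s / 2) / 2))

section ChiSq

variable {l : ℝ}

lemma continuousOn_marcumSeries_half (N : ℕ) (hl : 0 ≤ l) :
    ContinuousOn (fun s => -marcumSeries N l (s / 2)) (Ici 0) :=
  ((continuousOn_marcumSeries N hl).comp (by fun_prop : ContinuousOn (fun s : ℝ => s / 2) (Ici 0))
    fun s hs => div_nonneg (mem_Ici.1 hs) zero_le_two).neg

lemma hasDerivAt_neg_marcumSeries_half (N : ℕ) (hl : 0 ≤ l) {s : ℝ} (hs : 0 < s) :
    HasDerivAt (fun s => -marcumSeries N l (s / 2)) (marcumKernel N l (s / 2) / 2) s := by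
  have h2 : HasDerivAt (fun x : ℝ => x / 2) (1 / 2) s := (hasDerivAt_id s).div_const 2
  convert! ((hasDerivAt_marcumSeries N hl (half_pos hs)).comp s h2).neg using 1
  ring

lemma marcumKernel_half_nonneg (N : ℕ) (hl : 0 ≤ l) {s : ℝ} (hs : 0 < s) :
    0 ≤ marcumKernel N l (s / 2) / 2 :=
  div_nonneg (marcumKernel_nonneg N hl (half_pos hs).le) zero_le_two

lemma tendsto_neg_marcumSeries_half (N : ℕ) (hl : 0 ≤ l) :
    Tendsto (fun s => -marcumSeries N l (s / 2)) atTop (𝓝 0) := by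
  have h2 : Tendsto (fun x : ℝ => x / 2) atTop atTop := tendsto_id.atTop_div_const two_pos
  simpa using ((tendsto_marcumSeries_atTop N hl).comp h2).neg

lemma integrableOn_marcumKernel_half (N : ℕ) (hl : 0 ≤ l) :
    IntegrableOn (fun s => marcumKernel N l (s / 2) / 2) (Ioi 0) :=
  integrableOn_Ioi_deriv_of_nonneg (continuousOn_marcumSeries_half N hl 0 self_mem_Ici)
    (fun _ hs => hasDerivAt_neg_marcumSeries_half N hl hs)
    (fun _ hs => marcumKernel_half_nonneg N hl hs) (tendsto_neg_marcumSeries_half N hl)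

lemma integral_marcumKernel_half (n : ℕ) (hl : 0 ≤ l) :
    ∫ s in Ioi (0 : ℝ), marcumKernel (n + 1) l (s / 2) / 2 = 1 := by
  rw [integral_Ioi_of_hasDerivAt_of_nonneg (continuousOn_marcumSeries_half (n + 1) hl 0 self_mem_Ici)
    (fun _ hs => hasDerivAt_neg_marcumSeries_half (n + 1) hl hs)
    (fun _ hs => marcumKernel_half_nonneg (n + 1) hl hs) (tendsto_neg_marcumSeries_half (n + 1) hl)]
  simp [marcumSeries_succ_zero]

lemma isProbabilityMeasure_noncentralChiSq (n : ℕ) (hl : 0 ≤ l) :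
    IsProbabilityMeasure (noncentralChiSq (n + 1) l) where
  measure_univ := by
    rw [noncentralChiSq, withDensity_apply _ MeasurableSet.univ, Measure.restrict_univ,
      ← ofReal_integral_eq_lintegral_ofReal (integrableOn_marcumKernel_half (n + 1) hl),
      integral_marcumKernel_half n hl, ENNReal.ofReal_one]
    exact ae_restrict_of_forall_mem measurableSet_Ioi fun s hs =>
      marcumKernel_half_nonneg (n + 1) hl hs

lemma noncentralChiSq_Iio (n : ℕ) (hl : 0 ≤ l) {z : ℝ} (hz : 0 ≤ z) :
    noncentralChiSq (n + 1) l (Iio z) = ENNReal.ofReal (1 - marcumSeries (n + 1) l (z / 2)) := by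
  have h0 : noncentralChiSq (n + 1) l (Iio 0) = 0 := by
    rw [noncentralChiSq, withDensity_apply _ measurableSet_Iio,
      Measure.restrict_restrict measurableSet_Iio]
    have : Iio (0 : ℝ) ∩ Ioi 0 = ∅ := by ext x; simp; intro h; exact h.le
    simp [this]
  have h1 := withDensity_deriv_Ico (continuousOn_marcumSeries_half (n + 1) hl)
    (fun _ hs => hasDerivAt_neg_marcumSeries_half (n + 1) hl hs)
    (fun _ hs => marcumKernel_half_nonneg (n + 1) hl hs) le_rfl hz
  rw [← Iio_union_Ico_eq_Iio hz, measure_union _ measurableSet_Ico, h0, zero_add, noncentralChiSq,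
    h1, zero_div, marcumSeries_succ_zero]
  · ring_nf
  · exact Set.disjoint_left.2 fun x h1 h2 => not_lt.2 h2.1 h1

end ChiSq

/-! ### Identification by characteristic functions -/

section CharFun

open Complex

/-- The characteristic function of the chi-squared distribution with two degrees of freedom. -/
noncomputable def chiSqTwoChar (t : ℝ) : ℂ := (1 - 2 * t * I)⁻¹

lemma one_sub_two_mul_I_ne_zero (t : ℝ) : (1 - 2 * t * I : ℂ) ≠ 0 := by
  intro h
  simpa using congrArg Complex.re h

lemma marcumKernel_zero_left (n : ℕ) (s : ℝ) :
    marcumKernel (n + 1) 0 s = poissonWeight n s := by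
  rw [marcumKernel, tsum_eq_single 0]
  · simp [poissonWeight_zero_left, poissonPred]
  · intro j hj
    obtain ⟨j, rfl⟩ := Nat.exists_eq_succ_of_ne_zero hj
    simp [poissonWeight_succ_zero]

lemma integral_poissonWeight_half (k : ℕ) :
    IntegrableOn (fun s : ℝ => poissonWeight k (s / 2) / 2) (Ioi 0) ∧
      ∫ s in Ioi (0 : ℝ), poissonWeight k (s / 2) / 2 = 1 := by
  simp only [← marcumKernel_zero_left]
  exact ⟨integrableOn_marcumKernel_half (k + 1) le_rfl, integral_marcumKernel_half k le_rfl⟩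

lemma norm_cexp_mul_ofReal (t s x : ℝ) : ‖cexp (t * s * I) * (x : ℂ)‖ = ‖x‖ := by
  rw [norm_mul, ← Complex.ofReal_mul, Complex.norm_exp_ofReal_mul_I, one_mul, Complex.norm_real]

lemma integrableOn_cexp_mul {f : ℝ → ℝ} (hf : IntegrableOn f (Ioi 0)) (t : ℝ) :
    IntegrableOn (fun s : ℝ => cexp (t * s * I) * (f s : ℂ)) (Ioi 0) := by
  refine Integrable.mono hf ?_ (ae_of_all _ fun s => (norm_cexp_mul_ofReal t s (f s)).le)
  have : Continuous fun s : ℝ => cexp (t * s * I) := by fun_prop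
  exact this.aestronglyMeasurable.mul
    (Complex.continuous_ofReal.comp_aestronglyMeasurable hf.aestronglyMeasurable)

lemma hasDerivAt_cexp_mul {f : ℝ → ℝ} {f' s : ℝ} (hf : HasDerivAt f f' (s / 2)) (t : ℝ) :
    HasDerivAt (fun s : ℝ => cexp (t * s * I) * (f (s / 2) : ℂ))
      (t * I * (cexp (t * s * I) * (f (s / 2) : ℂ)) +
        cexp (t * s * I) * ((f' / 2 : ℝ) : ℂ)) s := by
  have h1 : HasDerivAt (fun s : ℝ => cexp (t * s * I)) (cexp (t * s * I) * (t * I)) s := by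
    have : HasDerivAt (fun s : ℝ => (t * s * I : ℂ)) (t * I) s := by
      simpa using ((Complex.ofRealCLM.hasDerivAt (x := s)).const_mul (t : ℂ)).mul_const I
    exact this.cexp
  have h2 : HasDerivAt (fun x : ℝ => x / 2) (1 / 2) s := (hasDerivAt_id s).div_const 2
  have h3 := (hf.comp s h2).ofReal_comp
  convert! h1.mul h3 using 1
  simp [div_eq_mul_inv]
  ring

lemma tendsto_cexp_mul {f : ℝ → ℝ} (hf : Tendsto f atTop (𝓝 0)) (t : ℝ) :
    Tendsto (fun s : ℝ => cexp (t * s * I) * (f (s / 2) : ℂ)) atTop (𝓝 0) := by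
  rw [tendsto_zero_iff_norm_tendsto_zero]
  simp only [norm_cexp_mul_ofReal]
  have h2 : Tendsto (fun x : ℝ => x / 2) atTop atTop := tendsto_id.atTop_div_const two_pos
  simpa using (hf.comp h2).norm

/-- Integrating the derivative of `exp(its)` times a Poisson weight over the half-line gives `(1 -
2it) J 0 = 1` and `(1 - 2it) J (k + 1) = J k`. -/
lemma integral_cexp_mul_poissonWeight (k : ℕ) (t : ℝ) :
    ∫ s in Ioi (0 : ℝ), cexp (t * s * I) * ((poissonWeight k (s / 2) / 2 : ℝ) : ℂ) =
      chiSqTwoChar t ^ (k + 1) := by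
  have hint := fun k => integrableOn_cexp_mul (integral_poissonWeight_half k).1 t
  have hw := one_sub_two_mul_I_ne_zero t
  set J : ℕ → ℂ := fun k =>
    ∫ s in Ioi (0 : ℝ), cexp (t * s * I) * ((poissonWeight k (s / 2) / 2 : ℝ) : ℂ) with hJ
  have h0 : (1 - 2 * t * I) * J 0 = 1 := by
    have hd : ∀ s ∈ Ici (0 : ℝ), HasDerivAt
        (fun s : ℝ => cexp (t * s * I) * (poissonWeight 0 (s / 2) : ℂ))
        ((2 * t * I - 1) * (cexp (t * s * I) * ((poissonWeight 0 (s / 2) / 2 : ℝ) : ℂ))) s := by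
      intro s _
      convert! hasDerivAt_cexp_mul (hasDerivAt_poissonWeight_zero (s / 2)) t using 1
      push_cast
      ring
    have := integral_Ioi_of_hasDerivAt_of_tendsto' hd ((hint 0).const_mul _)
      (tendsto_cexp_mul (tendsto_poissonWeight_atTop 0) t)
    rw [integral_const_mul] at this
    simp only [poissonWeight_zero_left] at this
    simp only [hJ, poissonWeight_zero_left]
    simp only [ofReal_zero, mul_zero, zero_mul, Complex.exp_zero, zero_div, neg_zero, Real.exp_zero,
      ofReal_one, mul_one, zero_sub] at this
    linear_combination -this
  have hs : ∀ k, (1 - 2 * t * I) * J (k + 1) = J k := by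
    intro k
    have hd : ∀ s ∈ Ici (0 : ℝ), HasDerivAt
        (fun s : ℝ => cexp (t * s * I) * (poissonWeight (k + 1) (s / 2) : ℂ))
        ((2 * t * I - 1) * (cexp (t * s * I) * ((poissonWeight (k + 1) (s / 2) / 2 : ℝ) : ℂ)) +
          cexp (t * s * I) * ((poissonWeight k (s / 2) / 2 : ℝ) : ℂ)) s := by
      intro s _
      convert! hasDerivAt_cexp_mul (hasDerivAt_poissonWeight_succ k (s / 2)) t using 1
      push_cast
      ring
    have := integral_Ioi_of_hasDerivAt_of_tendsto' hd (((hint (k + 1)).const_mul _).add (hint k))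
      (tendsto_cexp_mul (tendsto_poissonWeight_atTop (k + 1)) t)
    rw [integral_add ((hint (k + 1)).const_mul _) (hint k), integral_const_mul, zero_div,
      poissonWeight_succ_zero, ofReal_zero, mul_zero, sub_zero] at this
    simp only [hJ]
    linear_combination -this
  have key : ∀ k, J k = chiSqTwoChar t ^ (k + 1) := by
    intro k
    induction k with
    | zero => rw [zero_add, pow_one, chiSqTwoChar, eq_inv_of_mul_eq_one_right h0]
    | succ k ih =>
      rw [pow_succ, ← ih, ← hs k, chiSqTwoChar]
      field_simp
  exact key k

/-- The law is a Poisson(`l`) mixture of Gamma laws with characteristic functions `φ ^ (n + 1 + j)`,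
`φ = chiSqTwoChar t`, and the sum over `j` is an exponential series. Sum and integral commute
because the `L¹` norms of the terms are the Poisson weights. -/
lemma charFun_noncentralChiSq (n : ℕ) {l : ℝ} (hl : 0 ≤ l) (t : ℝ) :
    charFun (noncentralChiSq (n + 1) l) t =
      chiSqTwoChar t ^ (n + 1) * cexp (l * (chiSqTwoChar t - 1)) := by
  have hm : AEMeasurable (fun s => ENNReal.ofReal (marcumKernel (n + 1) l (s / 2) / 2))
      (volume.restrict (Ioi (0 : ℝ))) :=
    (integrableOn_marcumKernel_half (n + 1) hl).aemeasurable.ennreal_ofReal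
  rw [charFun_apply_real, noncentralChiSq, integral_withDensity_eq_integral_toReal_smul₀ hm
    (ae_of_all _ fun _ => ENNReal.ofReal_lt_top)]
  let F : ℕ → ℝ → ℂ := fun j s =>
    (poissonWeight j l : ℂ) * (cexp (t * s * I) * ((poissonWeight (n + j) (s / 2) / 2 : ℝ) : ℂ))
  have hF : ∀ j, IntegrableOn (F j) (Ioi 0) := fun j =>
    (integrableOn_cexp_mul (integral_poissonWeight_half (n + j)).1 t).const_mul _
  have hnorm : ∀ j, ∫ s in Ioi (0 : ℝ), ‖F j s‖ = poissonWeight j l := by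
    intro j
    simp only [F]
    simp_rw [norm_mul (poissonWeight j l : ℂ), norm_cexp_mul_ofReal]
    rw [integral_const_mul, Complex.norm_real, Real.norm_of_nonneg (poissonWeight_nonneg j hl),
      setIntegral_congr_fun measurableSet_Ioi (g := fun s => poissonWeight (n + j) (s / 2) / 2),
      (integral_poissonWeight_half (n + j)).2, mul_one]
    intro s hs
    exact Real.norm_of_nonneg
      (div_nonneg (poissonWeight_nonneg _ (half_pos hs).le) zero_le_two)
  have hsum := hasSum_integral_of_summable_integral_norm hF
    (by simpa only [hnorm] using summable_poissonWeight l)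
  have hL : ∀ s ∈ Ioi (0 : ℝ), (ENNReal.ofReal (marcumKernel (n + 1) l (s / 2) / 2)).toReal •
      cexp (t * s * I) = ∑' j, F j s := by
    intro s hs
    rw [ENNReal.toReal_ofReal (marcumKernel_half_nonneg (n + 1) hl hs), Complex.real_smul,
      marcumKernel, Complex.ofReal_div, Complex.ofReal_tsum, ← tsum_div_const, ← tsum_mul_right]
    refine tsum_congr fun j => ?_
    simp only [F, add_right_comm n 1 j, poissonPred]
    push_cast
    ring
  rw [setIntegral_congr_fun measurableSet_Ioi hL, ← hsum.tsum_eq]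
  have hI : ∀ j, ∫ s in Ioi (0 : ℝ), F j s =
      chiSqTwoChar t ^ (n + 1) * cexp (-l) * ((l * chiSqTwoChar t) ^ j / (j.factorial : ℂ)) := by
    intro j
    simp only [F]
    rw [integral_const_mul, integral_cexp_mul_poissonWeight, poissonWeight]
    push_cast
    ring
  simp_rw [hI]
  rw [tsum_mul_left, (NormedSpace.expSeries_div_hasSum_exp (𝔸 := ℂ) _).tsum_eq,
    ← Complex.exp_eq_exp_ℂ, mul_assoc, ← Complex.exp_add]
  ring_nf

/-- Completing the square. The constant `c` is a square root of `chiSqTwoChar t` independent of the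
shift `v`; its branch is irrelevant, since an even number of coordinates will be multiplied
together. -/
lemma integral_cexp_sq_gaussianReal (t : ℝ) :
    ∃ c : ℂ, c ^ 2 = chiSqTwoChar t ∧ ∀ v : ℝ,
      ∫ x, cexp (t * ((x + v) ^ 2 : ℝ) * I) ∂gaussianReal 0 1 =
        c * cexp ((v ^ 2 / 2 : ℝ) * (chiSqTwoChar t - 1)) := by
  have hw := one_sub_two_mul_I_ne_zero t
  have hb : (t * I - 1 / 2 : ℂ).re < 0 := by simp
  have hb' : (t * I - 1 / 2 : ℂ) = -(1 - 2 * t * I) / 2 := by ring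
  have hpi : (Real.pi : ℂ) ≠ 0 := by exact_mod_cast Real.pi_ne_zero
  refine ⟨((√(2 * Real.pi))⁻¹ : ℝ) * (Real.pi / -(t * I - 1 / 2)) ^ (1 / 2 : ℂ), ?_, fun v => ?_⟩
  · rw [mul_pow, ← Complex.ofReal_pow, inv_pow, Real.sq_sqrt (by positivity), hb', one_div,
      Complex.cpow_ofNat_inv_pow, chiSqTwoChar]
    push_cast
    field_simp
  · rw [integral_gaussianReal_eq_integral_smul one_ne_zero]
    have e : ∀ x : ℝ, gaussianPDFReal 0 1 x • cexp (t * ((x + v) ^ 2 : ℝ) * I) =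
        ((√(2 * Real.pi))⁻¹ : ℝ) *
          cexp ((t * I - 1 / 2) * x ^ 2 + (2 * t * v * I) * x + t * v ^ 2 * I) := by
      intro x
      rw [gaussianPDFReal, Complex.real_smul, Complex.ofReal_mul, NNReal.coe_one, mul_one,
        mul_assoc, Complex.ofReal_exp, ← Complex.exp_add]
      congr 2
      push_cast
      ring
    simp_rw [e]
    rw [integral_const_mul, integral_cexp_quadratic hb, ← mul_assoc]
    congr 2
    rw [hb', chiSqTwoChar]
    push_cast
    generalize hD : (1 - 2 * t * I : ℂ) = D at hw ⊢
    field_simp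
    rw [← hD]
    ring

/-- The squared norm of a shifted standard Gaussian vector is noncentral chi-squared. -/
lemma map_sum_add_sq_pi_gaussianReal {ι : Type*} [Fintype ι] (n : ℕ)
    (hι : Fintype.card ι = 2 * (n + 1)) (v : ι → ℝ) :
    (Measure.pi fun _ : ι => gaussianReal 0 1).map (fun w => ∑ i, (w i + v i) ^ 2) =
      noncentralChiSq (n + 1) ((∑ i, v i ^ 2) / 2) := by
  have hl : 0 ≤ (∑ i, v i ^ 2) / 2 := by positivity
  have hm : Measurable fun w : ι → ℝ => ∑ i, (w i + v i) ^ 2 := by fun_prop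
  have := isProbabilityMeasure_noncentralChiSq n hl
  have := Measure.isProbabilityMeasure_map (μ := Measure.pi fun _ : ι => gaussianReal 0 1)
    hm.aemeasurable
  refine Measure.ext_of_charFun (funext fun t => ?_)
  obtain ⟨c, hc, hcv⟩ := integral_cexp_sq_gaussianReal t
  rw [charFun_noncentralChiSq n hl, charFun_apply_real, integral_map hm.aemeasurable
    (by fun_prop)]
  have e : ∀ w : ι → ℝ, cexp (t * ((∑ i, (w i + v i) ^ 2 : ℝ) : ℂ) * I) =
      ∏ i, cexp (t * ((w i + v i) ^ 2 : ℝ) * I) := by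
    intro w
    rw [← Complex.exp_sum, Complex.ofReal_sum, Finset.mul_sum, Finset.sum_mul]
  simp_rw [e]
  rw [integral_fintype_prod_eq_prod (fun i x => cexp (t * ((x + v i) ^ 2 : ℝ) * I))]
  simp_rw [hcv]
  -- The `2 * (n + 1)` factors `c` combine into `(c ^ 2) ^ (n + 1)`, and the shifts enter only
  -- through the sum of their squares.
  rw [Finset.prod_mul_distrib, Finset.prod_const, Finset.card_univ, hι, pow_mul, hc,
    ← Complex.exp_sum, ← Finset.sum_mul, ← Complex.ofReal_sum, Finset.sum_div]

end CharFun

/-! ### The outage integral and its derivative in the threshold -/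

lemma measurable_marcumSeries_left (M : ℕ) {s : ℝ} (hs : 0 ≤ s) :
    Measurable fun l => marcumSeries M l s := by
  refine measurable_of_tendsto_metrizable
    (f := fun k l => ∑ j ∈ Finset.range k, poissonWeight j l * poissonLT (M + j) s)
    (fun k => Finset.measurable_fun_sum _ fun j _ =>
      (continuous_poissonWeight j).measurable.mul_const _) (tendsto_pi_nhds.2 fun l => ?_)
  -- Here `l` may be negative, so the weights are summed in absolute value.
  refine (Summable.of_norm_bounded (summable_poissonWeight l).norm fun j => ?_).hasSum.tendsto_sum_nat
  rw [norm_mul]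
  refine mul_le_of_le_one_right (norm_nonneg _) ?_
  rw [Real.norm_of_nonneg (poissonLT_nonneg _ hs)]
  exact poissonLT_le_one _ hs

/-- The noncentrality of the power at a port, given that the common components have squared
norm `r`, is twice this number. -/
noncomputable def portNoncentrality (μ r : ℝ) : ℝ := μ ^ 2 * r / (1 - μ ^ 2) / 2

section Outage

variable {μ : ℝ} (n K : ℕ)

lemma portNoncentrality_nonneg (hμ0 : 0 ≤ μ) (hμ1 : μ < 1) {r : ℝ} (hr : 0 ≤ r) :
    0 ≤ portNoncentrality μ r := by
  have : 0 ≤ 1 - μ ^ 2 := by nlinarith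
  unfold portNoncentrality
  positivity

lemma measurable_portNoncentrality (μ : ℝ) : Measurable (portNoncentrality μ) := by
  unfold portNoncentrality; fun_prop

/-- Since `√z = 0` for `z < 0`, clamping with `max z 0` makes the formula valid for every real `z`.
-/
lemma marcumQ_sqrt (hμ0 : 0 ≤ μ) (hμ1 : μ < 1) (M : ℕ) {r : ℝ} (hr : 0 ≤ r) (z : ℝ) :
    marcumQ M (Real.sqrt (μ ^ 2 * r / (1 - μ ^ 2))) (Real.sqrt z) =
      marcumSeries M (portNoncentrality μ r) (max z 0 / 2) := by
  have h := portNoncentrality_nonneg hμ0 hμ1 hr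
  rw [marcumQ_eq_marcumSeries M (Real.sqrt_nonneg _) (Real.sqrt_nonneg _),
    Real.sq_sqrt (by unfold portNoncentrality at h; linarith), portNoncentrality]
  congr 2
  rcases le_total 0 z with hz | hz
  · rw [Real.sq_sqrt hz, max_eq_left hz]
  · rw [Real.sqrt_eq_zero_of_nonpos hz, max_eq_right hz]; norm_num

lemma gamma_weight_eq (r : ℝ) :
    r ^ (n + 1 - 1) * Real.exp (-r / 2) / (2 ^ (n + 1) * Real.Gamma ((n + 1 : ℕ) : ℝ)) =
      poissonWeight n (r / 2) / 2 := by
  rw [Nat.add_sub_cancel, Nat.cast_add, Nat.cast_one, Real.Gamma_nat_eq_factorial, poissonWeight,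
    div_pow, neg_div]
  have : (n.factorial : ℝ) ≠ 0 := by positivity
  field_simp
  ring

lemma outageIntegrand_eq (hμ0 : 0 ≤ μ) (hμ1 : μ < 1) (z : ℝ) {r : ℝ} (hr : 0 ≤ r) :
    outageIntegrand (n + 1) K μ z r = poissonWeight n (r / 2) / 2 *
      (1 - marcumSeries (n + 1) (portNoncentrality μ r) (max z 0 / 2)) ^ K := by
  rw [outageIntegrand, gamma_weight_eq, marcumQ_sqrt hμ0 hμ1 _ hr]

/-- The power `2 ^ (N + 1)` splits into the `2 ^ N` of the Gamma density and a factor `1 / 2` from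
differentiating `z / 2`. -/
lemma densityIntegrand_eq (hμ0 : 0 ≤ μ) (hμ1 : μ < 1) (z : ℝ) {r : ℝ} (hr : 0 ≤ r) :
    densityIntegrand (n + 1) K μ z r = poissonWeight n (r / 2) / 2 *
      ((1 - marcumSeries (n + 1) (portNoncentrality μ r) (max z 0 / 2)) ^ (K - 1) *
        (marcumKernel (n + 1) (portNoncentrality μ r) (max z 0 / 2) / 2)) := by
  rw [densityIntegrand, marcumQ_sqrt hμ0 hμ1 _ hr, marcumQ_sqrt hμ0 hμ1 _ hr, Nat.add_sub_cancel n 1,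
    marcumSeries_succ_sub n (portNoncentrality_nonneg hμ0 hμ1 hr) (by positivity)]
  have := gamma_weight_eq n r
  rw [Nat.add_sub_cancel] at this
  rw [mul_div_assoc', mul_div_assoc', ← this, pow_succ 2 (n + 1)]
  have h1 : Real.Gamma ((n + 1 : ℕ) : ℝ) ≠ 0 := (Real.Gamma_pos_of_pos (by positivity)).ne'
  field_simp

lemma measurable_marcumSeries_noncentrality (M : ℕ) (μ z : ℝ) :
    Measurable fun r => marcumSeries M (portNoncentrality μ r) (max z 0 / 2) :=
  (measurable_marcumSeries_left M (by positivity)).comp (measurable_portNoncentrality μ)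

lemma one_sub_marcumSeries_mem (hμ0 : 0 ≤ μ) (hμ1 : μ < 1) (M : ℕ) {r : ℝ} (hr : 0 ≤ r) (z : ℝ) :
    1 - marcumSeries M (portNoncentrality μ r) (max z 0 / 2) ∈ Icc (0 : ℝ) 1 := by
  have h := portNoncentrality_nonneg hμ0 hμ1 hr
  have hz : 0 ≤ max z 0 / 2 := by positivity
  constructor
  · linarith [marcumSeries_le_one M h hz]
  · linarith [marcumSeries_nonneg M h hz]

lemma outageIntegrand_aestronglyMeasurable (hμ0 : 0 ≤ μ) (hμ1 : μ < 1) (z : ℝ) :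
    AEStronglyMeasurable (outageIntegrand (n + 1) K μ z) (volume.restrict (Ioi 0)) := by
  have hm : Measurable fun r => poissonWeight n (r / 2) / 2 *
      (1 - marcumSeries (n + 1) (portNoncentrality μ r) (max z 0 / 2)) ^ K :=
    (by fun_prop : Measurable fun r : ℝ => poissonWeight n (r / 2) / 2).mul
      (((measurable_marcumSeries_noncentrality (n + 1) μ z).const_sub 1).pow_const K)
  refine hm.aestronglyMeasurable.congr (ae_restrict_of_forall_mem measurableSet_Ioi fun r hr => ?_)
  exact (outageIntegrand_eq n K hμ0 hμ1 z (le_of_lt hr)).symm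

lemma densityIntegrand_aestronglyMeasurable (hμ0 : 0 ≤ μ) (hμ1 : μ < 1) (z : ℝ) :
    AEStronglyMeasurable (densityIntegrand (n + 1) K μ z) (volume.restrict (Ioi 0)) := by
  have hm : Measurable fun r => poissonWeight n (r / 2) / 2 *
      ((1 - marcumSeries (n + 1) (portNoncentrality μ r) (max z 0 / 2)) ^ (K - 1) *
        -- The kernel is written as a difference of consecutive orders, whose measurability in `r`
        -- is already known.
        ((marcumSeries (n + 1) (portNoncentrality μ r) (max z 0 / 2) -
          marcumSeries n (portNoncentrality μ r) (max z 0 / 2)) / 2)) :=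
    (by fun_prop : Measurable fun r : ℝ => poissonWeight n (r / 2) / 2).mul
      ((((measurable_marcumSeries_noncentrality (n + 1) μ z).const_sub 1).pow_const _).mul
        (((measurable_marcumSeries_noncentrality (n + 1) μ z).sub
          (measurable_marcumSeries_noncentrality n μ z)).div_const 2))
  refine hm.aestronglyMeasurable.congr (ae_restrict_of_forall_mem measurableSet_Ioi fun r hr => ?_)
  have hr : 0 ≤ r := le_of_lt hr
  simp only
  rw [densityIntegrand_eq n K hμ0 hμ1 z hr,
    marcumSeries_succ_sub n (portNoncentrality_nonneg hμ0 hμ1 hr) (by positivity)]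

lemma norm_outageIntegrand_le (hμ0 : 0 ≤ μ) (hμ1 : μ < 1) (z : ℝ) {r : ℝ} (hr : 0 ≤ r) :
    ‖outageIntegrand (n + 1) K μ z r‖ ≤ poissonWeight n (r / 2) / 2 := by
  have hw : 0 ≤ poissonWeight n (r / 2) := poissonWeight_nonneg n (by positivity)
  obtain ⟨h0, h1⟩ := one_sub_marcumSeries_mem hμ0 hμ1 (n + 1) hr z
  rw [outageIntegrand_eq n K hμ0 hμ1 z hr, Real.norm_of_nonneg (by positivity)]
  exact mul_le_of_le_one_right (by positivity) (pow_le_one₀ h0 h1)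

lemma densityIntegrand_mem (hμ0 : 0 ≤ μ) (hμ1 : μ < 1) (z : ℝ) {r : ℝ} (hr : 0 ≤ r) :
    densityIntegrand (n + 1) K μ z r ∈ Icc 0 (poissonWeight n (r / 2) / 2) := by
  have hw : 0 ≤ poissonWeight n (r / 2) := poissonWeight_nonneg n (by positivity)
  have hl := portNoncentrality_nonneg hμ0 hμ1 hr
  have hz : 0 ≤ max z 0 / 2 := by positivity
  obtain ⟨h0, h1⟩ := one_sub_marcumSeries_mem hμ0 hμ1 (n + 1) hr z
  have hk := marcumKernel_nonneg (n + 1) hl hz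
  rw [densityIntegrand_eq n K hμ0 hμ1 z hr]
  refine ⟨by positivity, mul_le_of_le_one_right (by positivity) ?_⟩
  exact mul_le_one₀ (pow_le_one₀ h0 h1) (by positivity)
    (by linarith [marcumKernel_le_one (n + 1) hl hz])

lemma integrableOn_outageIntegrand (hμ0 : 0 ≤ μ) (hμ1 : μ < 1) (z : ℝ) :
    IntegrableOn (outageIntegrand (n + 1) K μ z) (Ioi 0) :=
  Integrable.mono' (integral_poissonWeight_half n).1
    (outageIntegrand_aestronglyMeasurable n K hμ0 hμ1 z)
    (ae_restrict_of_forall_mem measurableSet_Ioi fun _ hr =>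
      norm_outageIntegrand_le n K hμ0 hμ1 z (le_of_lt hr))

lemma norm_densityIntegrand_le (hμ0 : 0 ≤ μ) (hμ1 : μ < 1) (z : ℝ) {r : ℝ} (hr : 0 ≤ r) :
    ‖densityIntegrand (n + 1) K μ z r‖ ≤ poissonWeight n (r / 2) / 2 := by
  obtain ⟨h0, h1⟩ := densityIntegrand_mem n K hμ0 hμ1 z hr
  rwa [Real.norm_of_nonneg h0]

lemma integrableOn_densityIntegrand (hμ0 : 0 ≤ μ) (hμ1 : μ < 1) (z : ℝ) :
    IntegrableOn (densityIntegrand (n + 1) K μ z) (Ioi 0) :=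
  Integrable.mono' (integral_poissonWeight_half n).1
    (densityIntegrand_aestronglyMeasurable n K hμ0 hμ1 z)
    (ae_restrict_of_forall_mem measurableSet_Ioi fun _ hr =>
      norm_densityIntegrand_le n K hμ0 hμ1 z (le_of_lt hr))

lemma maxDensity_nonneg (hμ0 : 0 ≤ μ) (hμ1 : μ < 1) (z : ℝ) : 0 ≤ maxDensity (n + 1) K μ z :=
  mul_nonneg (Nat.cast_nonneg K) (setIntegral_nonneg measurableSet_Ioi fun _ hr =>
    (densityIntegrand_mem n K hμ0 hμ1 z (le_of_lt hr)).1)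

lemma hasDerivAt_outageIntegrand (hμ0 : 0 ≤ μ) (hμ1 : μ < 1) {z r : ℝ} (hz : 0 < z) (hr : 0 ≤ r) :
    HasDerivAt (fun s => outageIntegrand (n + 1) K μ s r)
      (K * densityIntegrand (n + 1) K μ z r) z := by
  have hd := ((hasDerivAt_neg_marcumSeries_half (n + 1)
    (portNoncentrality_nonneg hμ0 hμ1 hr) hz).const_add 1).pow K
  have hd := hd.const_mul (poissonWeight n (r / 2) / 2)
  refine HasDerivAt.congr_of_eventuallyEq ?_ (f := fun s => poissonWeight n (r / 2) / 2 *
    (1 + -marcumSeries (n + 1) (portNoncentrality μ r) (s / 2)) ^ K) ?_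
  · convert! hd using 1
    rw [densityIntegrand_eq n K hμ0 hμ1 z hr, max_eq_left hz.le, ← sub_eq_add_neg]
    ring
  · filter_upwards [lt_mem_nhds hz] with s hs
    rw [outageIntegrand_eq n K hμ0 hμ1 s hr, max_eq_left (le_of_lt hs), sub_eq_add_neg]

/-- The series and its kernel lie in `[0, 1]`, so `K` times the Gamma density of `r` dominates the
derivative for all thresholds at once. -/
lemma hasDerivAt_integral_outageIntegrand (hμ0 : 0 ≤ μ) (hμ1 : μ < 1) {z : ℝ} (hz : 0 < z) :
    HasDerivAt (fun s => ∫ r in Ioi (0 : ℝ), outageIntegrand (n + 1) K μ s r)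
      (maxDensity (n + 1) K μ z) z := by
  have h := (hasDerivAt_integral_of_dominated_loc_of_deriv_le (μ := volume.restrict (Ioi (0 : ℝ)))
    (F := outageIntegrand (n + 1) K μ)
    (F' := fun s r => K * densityIntegrand (n + 1) K μ s r) (x₀ := z) (s := Ioi 0)
    (bound := fun r => K * (poissonWeight n (r / 2) / 2)) (Ioi_mem_nhds hz)
    (Eventually.of_forall fun s => outageIntegrand_aestronglyMeasurable n K hμ0 hμ1 s)
    (integrableOn_outageIntegrand n K hμ0 hμ1 z)
    ((densityIntegrand_aestronglyMeasurable n K hμ0 hμ1 z).const_mul _)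
    (ae_restrict_of_forall_mem measurableSet_Ioi fun r hr s _ => by
      rw [norm_mul, Real.norm_natCast]
      exact mul_le_mul_of_nonneg_left (norm_densityIntegrand_le n K hμ0 hμ1 s (le_of_lt hr))
        (Nat.cast_nonneg K))
    ((integral_poissonWeight_half n).1.const_mul _)
    (ae_restrict_of_forall_mem measurableSet_Ioi fun r hr s hs =>
      hasDerivAt_outageIntegrand n K hμ0 hμ1 hs (le_of_lt hr))).2
  rwa [integral_const_mul] at h

lemma continuous_integral_outageIntegrand (hμ0 : 0 ≤ μ) (hμ1 : μ < 1) :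
    Continuous fun s => ∫ r in Ioi (0 : ℝ), outageIntegrand (n + 1) K μ s r := by
  refine continuous_of_dominated (bound := fun r => poissonWeight n (r / 2) / 2)
    (fun s => outageIntegrand_aestronglyMeasurable n K hμ0 hμ1 s)
    (fun s => ae_restrict_of_forall_mem measurableSet_Ioi fun r hr =>
      norm_outageIntegrand_le n K hμ0 hμ1 s (le_of_lt hr)) (integral_poissonWeight_half n).1
    (ae_restrict_of_forall_mem measurableSet_Ioi fun r hr => ?_)
  have hr : 0 ≤ r := le_of_lt hr
  simp only [fun s => outageIntegrand_eq n K hμ0 hμ1 s hr]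
  have hc : Continuous fun s =>
      marcumSeries (n + 1) (portNoncentrality μ r) (max s 0 / 2) :=
    (continuousOn_marcumSeries (n + 1) (portNoncentrality_nonneg hμ0 hμ1 hr)).comp_continuous
      (by fun_prop) fun s => by simp only [mem_Ici]; positivity
  fun_prop

/-- On `(0, ∞)` the density is the derivative of a function of one variable, which avoids joint
measurability in `(t, r)`. -/
lemma aemeasurable_maxDensity (hμ0 : 0 ≤ μ) (hμ1 : μ < 1) :
    AEMeasurable (maxDensity (n + 1) K μ) (volume.restrict (Ioi 0)) := by
  refine (measurable_deriv fun s => ∫ r in Ioi (0 : ℝ),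
    outageIntegrand (n + 1) K μ s r).aemeasurable.congr
    (ae_restrict_of_forall_mem measurableSet_Ioi fun z hz => ?_)
  exact (hasDerivAt_integral_outageIntegrand n K hμ0 hμ1 hz).deriv

end Outage

/-! ### From distribution function to density -/

/-- A nonnegative variable whose distribution function on `[0, ∞)` is `G` has density `G'`. -/
lemma map_eq_withDensity_of_measureReal_lt {Ω : Type*} [MeasurableSpace Ω] {ρ : Measure Ω}
    [IsProbabilityMeasure ρ] {Z : Ω → ℝ} (hZ : AEMeasurable Z ρ) (hZ0 : ∀ ω, 0 ≤ Z ω)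
    {G g : ℝ → ℝ} (hG : ContinuousOn G (Ici 0)) (hderiv : ∀ t, 0 < t → HasDerivAt G (g t) t)
    (hg : ∀ t, 0 < t → 0 ≤ g t) (hZG : ∀ z, 0 ≤ z → ρ.real {ω | Z ω < z} = G z) :
    ρ.map Z = (volume.restrict (Ioi (0 : ℝ))).withDensity (fun t => ENNReal.ofReal (g t)) := by
  have := Measure.isProbabilityMeasure_map hZ
  have hIio : ∀ z, 0 ≤ z → ρ.map Z (Iio z) = ENNReal.ofReal (G z) := by
    intro z hz
    rw [Measure.map_apply_of_aemeasurable hZ measurableSet_Iio, ← hZG z hz, ofReal_measureReal]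
    rfl
  have hG0 : ∀ z, 0 ≤ z → 0 ≤ G z := fun z hz => hZG z hz ▸ measureReal_nonneg
  have hIco : ∀ a b, 0 ≤ a → a ≤ b → ρ.map Z (Ico a b) =
      (volume.restrict (Ioi (0 : ℝ))).withDensity (fun t => ENNReal.ofReal (g t)) (Ico a b) := by
    intro a b ha hab
    rw [withDensity_deriv_Ico hG hderiv hg ha hab, ← Iio_sdiff_Iio,
      measure_sdiff (Iio_subset_Iio hab) measurableSet_Iio.nullMeasurableSet (measure_ne_top _ _),
      hIio b (ha.trans hab), hIio a ha, ENNReal.ofReal_sub _ (hG0 a ha)]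
  have hneg : ρ.map Z (Iio 0) = 0 := by
    rw [Measure.map_apply_of_aemeasurable hZ measurableSet_Iio]
    have : Z ⁻¹' Iio 0 = ∅ := by ext ω; simpa using hZ0 ω
    rw [this, measure_empty]
  have hneg' : (volume.restrict (Ioi (0 : ℝ))).withDensity
      (fun t => ENNReal.ofReal (g t)) (Iio 0) = 0 := by
    rw [withDensity_apply _ measurableSet_Iio, Measure.restrict_restrict measurableSet_Iio]
    have : Iio (0 : ℝ) ∩ Ioi 0 = ∅ := by ext x; simp; intro h; exact h.le
    simp [this]
  -- Half-open intervals determine the measure; those straddling `0` are cut there, as neither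
  -- measure charges the negative half-line.
  refine Measure.ext_of_Ico _ _ fun a b hab => ?_
  rcases le_total 0 a with ha | ha
  · exact hIco a b ha hab.le
  rcases le_total b 0 with hb | hb
  · have hs : Ico a b ⊆ Iio 0 := fun x hx => hx.2.trans_le hb
    rw [measure_mono_null hs hneg, measure_mono_null hs hneg']
  · have hs : Ico a 0 ⊆ Iio 0 := fun x hx => hx.2
    rw [← Ico_union_Ico_eq_Ico ha hb, measure_union _ measurableSet_Ico,
      measure_union _ measurableSet_Ico, hIco 0 b le_rfl hb, measure_mono_null hs hneg,
      measure_mono_null hs hneg']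
    all_goals exact Set.disjoint_left.2 fun x h1 h2 => not_lt.2 h2.1 h1.2

/-! ### Reduction to Gaussian vectors indexed by port -/

section Reshape

variable {Ω : Type*} {N K : ℕ}

/-- All the Gaussian components, grouped by port; port `0` carries the common components. -/
def componentArray (x y : Fin N → Fin (K + 1) → Ω → ℝ) (ω : Ω) (k : Fin (K + 1)) :
    Fin N ⊕ Fin N → ℝ :=
  Sum.elim (fun m => x m k ω) (fun m => y m k ω)

/-- The squared norm of `w + c u`. -/
noncomputable def shiftedNormSq {ι : Type*} [Fintype ι] (c : ℝ) (u w : ι → ℝ) : ℝ :=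
  ∑ i, (w i + c * u i) ^ 2

lemma measurable_shiftedNormSq {ι : Type*} [Fintype ι] (c : ℝ) :
    Measurable fun p : (ι → ℝ) × (ι → ℝ) => shiftedNormSq c p.1 p.2 := by
  unfold shiftedNormSq; fun_prop

lemma normalizedPower_eq (μ : ℝ) (x y : Fin N → Fin (K + 1) → Ω → ℝ) (k : Fin K) (ω : Ω) :
    normalizedPower μ x y k ω = shiftedNormSq (μ / Real.sqrt (1 - μ ^ 2))
      (componentArray x y ω 0) (componentArray x y ω k.succ) := by
  simp [normalizedPower, shiftedNormSq, componentArray, Fintype.sum_sum_type,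
    Finset.sum_add_distrib]

lemma normalizedPower_nonneg (μ : ℝ) (x y : Fin N → Fin (K + 1) → Ω → ℝ) (k : Fin K) (ω : Ω) :
    0 ≤ normalizedPower μ x y k ω :=
  Finset.sum_nonneg fun _ _ => by positivity

lemma maxNormalizedPower_nonneg (μ : ℝ) (x y : Fin N → Fin (K + 1) → Ω → ℝ) (ω : Ω) :
    0 ≤ maxNormalizedPower μ x y ω :=
  Real.iSup_nonneg fun k => normalizedPower_nonneg μ x y k ω

lemma normalizedPower_le_max (μ : ℝ) (x y : Fin N → Fin (K + 1) → Ω → ℝ) (k : Fin K) (ω : Ω) :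
    normalizedPower μ x y k ω ≤ maxNormalizedPower μ x y ω :=
  le_ciSup (f := fun k => normalizedPower μ x y k ω) (finite_range _).bddAbove k

lemma maxNormalizedPower_lt_iff (hK : 1 ≤ K) (μ : ℝ) (x y : Fin N → Fin (K + 1) → Ω → ℝ) (ω : Ω)
    (z : ℝ) : maxNormalizedPower μ x y ω < z ↔ ∀ k, normalizedPower μ x y k ω < z := by
  refine ⟨fun h k => (normalizedPower_le_max μ x y k ω).trans_lt h, fun h => ?_⟩
  have : Nonempty (Fin K) := ⟨⟨0, hK⟩⟩
  obtain ⟨k, hk⟩ := exists_eq_ciSup_of_finite (f := fun k => normalizedPower μ x y k ω)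
  exact hk.symm.trans_lt (h k)

lemma harvestPower_eq {μ : ℝ} (hμ0 : 0 ≤ μ) (hμ1 : μ < 1) (P : ℝ)
    (x y : Fin N → Fin (K + 1) → Ω → ℝ) (k : Fin K) (ω : Ω) :
    harvestPower (fun _ => P) μ x y k ω = P * (1 - μ ^ 2) * normalizedPower μ x y k ω := by
  have h : 0 < 1 - μ ^ 2 := by nlinarith
  rw [harvestPower, normalizedPower, Finset.mul_sum]
  refine Finset.sum_congr rfl fun m _ => ?_
  have hs : Real.sqrt (1 - μ ^ 2) ^ 2 = 1 - μ ^ 2 := Real.sq_sqrt h.le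
  have hs0 : Real.sqrt (1 - μ ^ 2) ≠ 0 := (Real.sqrt_pos.2 h).ne'
  rw [channelGain, mul_comm Complex.I, Complex.sq_norm, Complex.normSq_add_mul_I, mul_assoc]
  set q := Real.sqrt (1 - μ ^ 2)
  rw [← hs]
  field_simp

/-- The activated port harvests the maximal power. -/
lemma harvestPower_argmax_eq {μ P : ℝ} (hμ0 : 0 ≤ μ) (hμ1 : μ < 1) (hP : 0 < P)
    (x y : Fin N → Fin (K + 1) → Ω → ℝ) (ω : Ω) (k₀ : Fin K)
    (hk₀ : ∀ k, harvestPower (fun _ => P) μ x y k ω ≤ harvestPower (fun _ => P) μ x y k₀ ω) :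
    harvestPower (fun _ => P) μ x y k₀ ω = P * (1 - μ ^ 2) * maxNormalizedPower μ x y ω := by
  have h : 0 < P * (1 - μ ^ 2) := mul_pos hP (by nlinarith)
  have : Nonempty (Fin K) := ⟨k₀⟩
  rw [harvestPower_eq hμ0 hμ1]
  congr 1
  refine le_antisymm (normalizedPower_le_max μ x y k₀ ω) (ciSup_le fun k => ?_)
  have := hk₀ k
  rw [harvestPower_eq hμ0 hμ1, harvestPower_eq hμ0 hμ1] at this
  exact le_of_mul_le_mul_left this h

end Reshape

section Law

variable {Ω : Type*} [MeasurableSpace Ω] {ρ : Measure Ω} {N K : ℕ}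
  {x y : Fin N → Fin (K + 1) → Ω → ℝ}

/-- Reindexing by (port, component) is injective, so independence survives; currying the resulting
product measure gives `K + 1` independent Gaussian vectors in dimension `2N`. -/
lemma map_componentArray [IsProbabilityMeasure ρ]
    (hx : ∀ m k, HasLaw (x m k) (gaussianReal 0 1) ρ)
    (hy : ∀ m k, HasLaw (y m k) (gaussianReal 0 1) ρ)
    (hindep : iIndepFun (Sum.elim (fun p : Fin N × Fin (K + 1) => x p.1 p.2)
      (fun p : Fin N × Fin (K + 1) => y p.1 p.2)) ρ) :
    AEMeasurable (componentArray x y) ρ ∧ ρ.map (componentArray x y) =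
      Measure.pi fun _ : Fin (K + 1) => Measure.pi fun _ : Fin N ⊕ Fin N => gaussianReal 0 1 := by
  let e : Fin (K + 1) × (Fin N ⊕ Fin N) → (Fin N × Fin (K + 1)) ⊕ (Fin N × Fin (K + 1)) :=
    fun p => p.2.map (fun m => (m, p.1)) (fun m => (m, p.1))
  have he : Function.Injective e := by
    rintro ⟨k, m | m⟩ ⟨k', m' | m'⟩ h <;> simp_all [e]
  let f : Fin (K + 1) × (Fin N ⊕ Fin N) → Ω → ℝ := fun p ω => componentArray x y ω p.1 p.2
  have hf : ∀ p, HasLaw (f p) (gaussianReal 0 1) ρ := by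
    rintro ⟨k, m | m⟩
    · exact hx m k
    · exact hy m k
  have hfi : iIndepFun f ρ := by
    convert! hindep.precomp he using 1
    ext ⟨k, m | m⟩ ω <;> rfl
  have hmeas : AEMeasurable (componentArray x y) ρ :=
    aemeasurable_pi_lambda _ fun k => aemeasurable_pi_lambda _ fun m => (hf (k, m)).aemeasurable
  refine ⟨hmeas, ?_⟩
  have h1 := (iIndepFun_iff_map_fun_eq_pi_map fun p => (hf p).aemeasurable).1 hfi
  simp only [(hf _).map_eq] at h1
  have h2 := Measure.infinitePi_map_curry (ι := Fin (K + 1)) (κ := Fin N ⊕ Fin N)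
    fun _ _ => gaussianReal 0 1
  simp only [Measure.infinitePi_eq_pi] at h2
  rw [← h2, ← h1, AEMeasurable.map_map_of_aemeasurable (MeasurableEquiv.measurable _).aemeasurable
    (aemeasurable_pi_lambda _ fun p => (hf p).aemeasurable)]
  rfl

lemma aemeasurable_maxNormalizedPower (hW : AEMeasurable (componentArray x y) ρ) (μ : ℝ) :
    AEMeasurable (maxNormalizedPower μ x y) ρ := by
  have h : ∀ j, AEMeasurable (fun ω => componentArray x y ω j) ρ := fun j =>
    (measurable_pi_apply j).comp_aemeasurable hW
  have hk : ∀ k, AEMeasurable (normalizedPower μ x y k) ρ := by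
    intro k
    have := (measurable_shiftedNormSq (μ / Real.sqrt (1 - μ ^ 2))).comp_aemeasurable
      ((h 0).prodMk (h k.succ))
    exact this.congr (ae_of_all _ fun ω => (normalizedPower_eq μ x y k ω).symm)
  have hs : AEMeasurable (fun ω => ⨆ k : Fin K, normalizedPower μ x y k ω) ρ :=
    AEMeasurable.iSup hk
  exact hs

end Law

/-! ### The distribution function and integrability of the maximum -/

section Distribution

variable {ι : Type*} [Fintype ι]

/-- Conditioning on the component `0`, shared by the other ones. -/
lemma pi_setOf_forall_shiftedNormSq_lt (γ : Measure (ι → ℝ)) [IsProbabilityMeasure γ] (K : ℕ)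
    (c z : ℝ) :
    (Measure.pi fun _ : Fin (K + 1) => γ) {w | ∀ k : Fin K, shiftedNormSq c (w 0) (w k.succ) < z} =
      ∫⁻ u, γ {w | shiftedNormSq c u w < z} ^ K ∂γ := by
  have hmp := measurePreserving_piFinSuccAbove (fun _ : Fin (K + 1) => γ) 0
  let B : Set ((ι → ℝ) × (Fin K → ι → ℝ)) := {p | ∀ k, shiftedNormSq c p.1 (p.2 k) < z}
  have hB : MeasurableSet B := by
    simp only [B, ofPred_forall]
    refine MeasurableSet.iInter fun k => measurableSet_lt ?_ measurable_const
    exact (measurable_shiftedNormSq c).comp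
      (measurable_fst.prodMk ((measurable_pi_apply k).comp measurable_snd))
  have e : {w : Fin (K + 1) → ι → ℝ | ∀ k : Fin K, shiftedNormSq c (w 0) (w k.succ) < z} =
      MeasurableEquiv.piFinSuccAbove (fun _ => ι → ℝ) 0 ⁻¹' B := by
    ext w; rfl
  rw [e, hmp.measure_preimage hB.nullMeasurableSet, Measure.prod_apply hB]
  refine lintegral_congr fun u => ?_
  -- With the common component fixed, the event is a product of `K` copies of one set.
  have e2 : Prod.mk u ⁻¹' B = univ.pi fun _ : Fin K => {w | shiftedNormSq c u w < z} := by
    ext f; simp [B]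
  rw [e2, Measure.pi_pi, Finset.prod_const, Finset.card_univ, Fintype.card_fin]

lemma pi_gaussianReal_shiftedNormSq_lt (n : ℕ) (hι : Fintype.card ι = 2 * (n + 1)) (c : ℝ)
    (u : ι → ℝ) {z : ℝ} (hz : 0 ≤ z) :
    (Measure.pi fun _ : ι => gaussianReal 0 1) {w | shiftedNormSq c u w < z} =
      ENNReal.ofReal (1 - marcumSeries (n + 1) (c ^ 2 * (∑ i, u i ^ 2) / 2) (z / 2)) := by
  have h := map_sum_add_sq_pi_gaussianReal n hι fun i => c * u i
  simp only [mul_pow, ← Finset.mul_sum] at h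
  rw [← noncentralChiSq_Iio n (by positivity) hz, ← h, Measure.map_apply (by fun_prop)
    measurableSet_Iio]
  rfl

end Distribution

lemma measureReal_maxNormalizedPower_lt {Ω : Type*} [MeasurableSpace Ω] {ρ : Measure Ω}
    [IsProbabilityMeasure ρ] {n K : ℕ} {x y : Fin (n + 1) → Fin (K + 1) → Ω → ℝ} (hK : 1 ≤ K)
    {μ : ℝ} (hμ0 : 0 ≤ μ) (hμ1 : μ < 1) (hW : AEMeasurable (componentArray x y) ρ)
    (hlaw : ρ.map (componentArray x y) = Measure.pi fun _ : Fin (K + 1) =>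
      Measure.pi fun _ : Fin (n + 1) ⊕ Fin (n + 1) => gaussianReal 0 1) {z : ℝ} (hz : 0 ≤ z) :
    ρ.real {ω | maxNormalizedPower μ x y ω < z} =
      ∫ r in Ioi (0 : ℝ), outageIntegrand (n + 1) K μ z r := by
  set c := μ / Real.sqrt (1 - μ ^ 2) with hc
  have hc2 : ∀ r, c ^ 2 * r / 2 = portNoncentrality μ r := by
    intro r
    rw [hc, div_pow, Real.sq_sqrt (by nlinarith), portNoncentrality]
    ring
  have hι : Fintype.card (Fin (n + 1) ⊕ Fin (n + 1)) = 2 * (n + 1) := by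
    simp [two_mul]
  let A : Set (Fin (K + 1) → Fin (n + 1) ⊕ Fin (n + 1) → ℝ) :=
    {w | ∀ k : Fin K, shiftedNormSq c (w 0) (w k.succ) < z}
  have hA : MeasurableSet A := by
    simp only [A, ofPred_forall]
    refine MeasurableSet.iInter fun k => measurableSet_lt ?_ measurable_const
    have hpair : Measurable fun w : Fin (K + 1) → Fin (n + 1) ⊕ Fin (n + 1) → ℝ =>
        (w 0, w k.succ) := by fun_prop
    exact (measurable_shiftedNormSq c).comp hpair
  have e : {ω | maxNormalizedPower μ x y ω < z} = componentArray x y ⁻¹' A := by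
    ext ω
    simp only [mem_ofPred_eq, maxNormalizedPower_lt_iff hK, normalizedPower_eq, mem_preimage, A, hc]
  let H : ℝ → ENNReal := fun r =>
    ENNReal.ofReal (1 - marcumSeries (n + 1) (portNoncentrality μ r) (max z 0 / 2)) ^ K
  have hH : Measurable H :=
    ((measurable_marcumSeries_noncentrality (n + 1) μ z).const_sub 1).ennreal_ofReal.pow_const K
  have hmeas : ρ {ω | maxNormalizedPower μ x y ω < z} =
      ∫⁻ r in Ioi (0 : ℝ), ENNReal.ofReal (outageIntegrand (n + 1) K μ z r) := by
    rw [e, ← Measure.map_apply_of_aemeasurable hW hA, hlaw, pi_setOf_forall_shiftedNormSq_lt]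
    simp_rw [pi_gaussianReal_shiftedNormSq_lt n hι c _ hz, hc2]
    -- The conditional probability depends on `u` only through its squared norm; zero shift gives
    -- the law of that norm, the central chi-squared one.
    have h0 := map_sum_add_sq_pi_gaussianReal n hι fun _ => 0
    simp only [add_zero, ne_eq, OfNat.ofNat_ne_zero, not_false_eq_true, zero_pow,
      Finset.sum_const_zero, zero_div] at h0
    have h1 := lintegral_map (μ := Measure.pi fun _ : Fin (n + 1) ⊕ Fin (n + 1) => gaussianReal 0 1)
      (g := fun w => ∑ i, w i ^ 2) hH (by fun_prop)
    simp only [H, max_eq_left hz] at h1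
    rw [← h1, h0, noncentralChiSq, lintegral_withDensity_eq_lintegral_mul₀
      (integrableOn_marcumKernel_half (n + 1) le_rfl).aemeasurable.ennreal_ofReal
      (by simpa only [H, max_eq_left hz] using hH.aemeasurable)]
    refine setLIntegral_congr_fun measurableSet_Ioi fun r hr => ?_
    have hr : 0 ≤ r := le_of_lt hr
    have hm := (one_sub_marcumSeries_mem hμ0 hμ1 (n + 1) hr z).1
    have hw : 0 ≤ poissonWeight n (r / 2) := poissonWeight_nonneg n (by positivity)
    rw [outageIntegrand_eq n K hμ0 hμ1 z hr, ENNReal.ofReal_mul (by positivity),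
      ENNReal.ofReal_pow hm, max_eq_left hz, Pi.mul_apply, marcumKernel_zero_left]
  rw [measureReal_def, hmeas, ← integral_eq_lintegral_of_nonneg_ae _
    (outageIntegrand_aestronglyMeasurable n K hμ0 hμ1 z)]
  refine ae_restrict_of_forall_mem measurableSet_Ioi fun r hr => ?_
  have hr : 0 ≤ r := le_of_lt hr
  have hm := (one_sub_marcumSeries_mem hμ0 hμ1 (n + 1) hr z).1
  have hw : 0 ≤ poissonWeight n (r / 2) := poissonWeight_nonneg n (by positivity)
  simp only [outageIntegrand_eq n K hμ0 hμ1 z hr, Pi.zero_apply]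
  positivity

/-- The maximum of the nonnegative `Y_k` is at most their sum, and each `Y_k` is a finite sum of
squares of `L²` variables. -/
lemma integrable_maxNormalizedPower {Ω : Type*} [MeasurableSpace Ω] {ρ : Measure Ω}
    [IsProbabilityMeasure ρ] {N K : ℕ} {x y : Fin N → Fin (K + 1) → Ω → ℝ} (hK : 1 ≤ K)
    (hx : ∀ m k, HasLaw (x m k) (gaussianReal 0 1) ρ)
    (hy : ∀ m k, HasLaw (y m k) (gaussianReal 0 1) ρ) (μ : ℝ)
    (hZ : AEMeasurable (maxNormalizedPower μ x y) ρ) :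
    Integrable (maxNormalizedPower μ x y) ρ := by
  have hL2 : ∀ X : Ω → ℝ, HasLaw X (gaussianReal 0 1) ρ → MemLp X 2 ρ := by
    intro X hX
    have h := memLp_id_gaussianReal (μ := 0) (v := 1) 2
    rw [← hX.map_eq] at h
    exact (memLp_map_measure_iff (by fun_prop) hX.aemeasurable).1 h
  have hY : ∀ k, Integrable (normalizedPower μ x y k) ρ := fun k =>
    integrable_finsetSum _ fun m _ =>
      (((hL2 _ (hx m k.succ)).add ((hL2 _ (hx m 0)).const_mul _)).integrable_sq).add
        (((hL2 _ (hy m k.succ)).add ((hL2 _ (hy m 0)).const_mul _)).integrable_sq)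
  refine Integrable.mono' (integrable_finsetSum Finset.univ fun k _ => hY k)
    hZ.aestronglyMeasurable (ae_of_all _ fun ω => ?_)
  rw [Real.norm_of_nonneg (maxNormalizedPower_nonneg μ x y ω)]
  have : Nonempty (Fin K) := ⟨⟨0, hK⟩⟩
  exact ciSup_le fun k => Finset.single_le_sum (f := fun k => normalizedPower μ x y k ω)
    (fun j _ => normalizedPower_nonneg μ x y j ω) (Finset.mem_univ k)

theorem theorem3 {Ω : Type*} [MeasurableSpace Ω] (ρ : Measure Ω) [IsProbabilityMeasure ρ]
    {N K : ℕ} (hK : 1 ≤ K) (i : Fin N) (μ P T : ℝ) (α : Fin N → ℝ)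
    (hμ0 : 0 ≤ μ) (hμ1 : μ < 1) (hP : 0 < P)
    -- `x m i k`, `y m i k`: the Gaussian components of the channel from AP `m` to user `i`
    (x y : Fin N → Fin N → Fin (K + 1) → Ω → ℝ)
    (hx : ∀ m k, HasLaw (x m i k) (gaussianReal 0 1) ρ)
    (hy : ∀ m k, HasLaw (y m i k) (gaussianReal 0 1) ρ)
    (hindep : iIndepFun (Sum.elim (fun p : Fin N × Fin (K + 1) => x p.1 i p.2)
      (fun p : Fin N × Fin (K + 1) => y p.1 i p.2)) ρ)
    -- `kstar` is the port that maximizes the harvested power of user `i`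
    (kstar : Ω → Fin K)
    (hkstar : ∀ ω k, harvestPower (fun _ => P) μ (fun m => x m i) (fun m => y m i) k ω ≤
      harvestPower (fun _ => P) μ (fun m => x m i) (fun m => y m i) (kstar ω) ω) :
    -- the expectations exist, and `E_avg = ψ_i E[max_k Y_k]`
    (Integrable (fun ω => harvestPower (fun _ => P) μ (fun m => x m i) (fun m => y m i)
        (kstar ω) ω) ρ ∧
      Integrable (maxNormalizedPower μ (fun m => x m i) (fun m => y m i)) ρ ∧
      avgHarvestedEnergy ρ (α i) T (fun _ => P) μ (fun m => x m i) (fun m => y m i) kstar =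
        (1 - α i) * (1 - μ ^ 2) * T * P *
          ∫ ω, maxNormalizedPower μ (fun m => x m i) (fun m => y m i) ω ∂ρ) ∧
    -- the distribution function of `Z` is the outage-probability integral
    (∀ z : ℝ, 0 ≤ z →
      IntegrableOn (outageIntegrand N K μ z) (Ioi 0) ∧
      ρ.real {ω | maxNormalizedPower μ (fun m => x m i) (fun m => y m i) ω < z} =
        ∫ r in Ioi (0 : ℝ), outageIntegrand N K μ z r) ∧
    -- it can be differentiated under the integral sign, and the derivative is `f_Z`
    (∀ z : ℝ, 0 < z →
      (∀ r : ℝ, 0 < r → HasDerivAt (fun s => outageIntegrand N K μ s r)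
        (K * densityIntegrand N K μ z r) z) ∧
      IntegrableOn (densityIntegrand N K μ z) (Ioi 0) ∧
      HasDerivAt (fun s => ∫ r in Ioi (0 : ℝ), outageIntegrand N K μ s r)
        (maxDensity N K μ z) z) ∧
    -- `f_Z` is the density of `Z`
    (ρ.map (maxNormalizedPower μ (fun m => x m i) (fun m => y m i)) =
      (volume.restrict (Ioi (0 : ℝ))).withDensity
        (fun t => ENNReal.ofReal (maxDensity N K μ t))) ∧
    -- the average harvested energy as `ψ_i ∫ t f_Z(t) dt`, and written out as a double integral
    IntegrableOn (fun t : ℝ => t * maxDensity N K μ t) (Ioi 0) ∧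
    avgHarvestedEnergy ρ (α i) T (fun _ => P) μ (fun m => x m i) (fun m => y m i) kstar =
      (1 - α i) * (1 - μ ^ 2) * T * P * ∫ t in Ioi (0 : ℝ), t * maxDensity N K μ t ∧
    avgHarvestedEnergy ρ (α i) T (fun _ => P) μ (fun m => x m i) (fun m => y m i) kstar =
      (1 - α i) * (1 - μ ^ 2) * T * P * ∫ t in Ioi (0 : ℝ), K * t * ∫ r in Ioi (0 : ℝ),
        r ^ (N - 1) * Real.exp (-r / 2) / (2 ^ (N + 1) * Real.Gamma N) *
        (1 - marcumQ N (Real.sqrt (μ ^ 2 * r / (1 - μ ^ 2))) (Real.sqrt t)) ^ (K - 1) *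
        (marcumQ N (Real.sqrt (μ ^ 2 * r / (1 - μ ^ 2))) (Real.sqrt t) -
          marcumQ (N - 1) (Real.sqrt (μ ^ 2 * r / (1 - μ ^ 2))) (Real.sqrt t)) := by
  -- The existence of the user `i : Fin N` forces `N ≥ 1`.
  obtain ⟨n, rfl⟩ : ∃ n, N = n + 1 := Nat.exists_eq_succ_of_ne_zero i.pos.ne'
  obtain ⟨hW, hlaw⟩ := map_componentArray (x := fun m => x m i) (y := fun m => y m i) hx hy hindep
  have hZ := aemeasurable_maxNormalizedPower hW μ
  have hZint := integrable_maxNormalizedPower hK hx hy μ hZ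
  have hcdf : ∀ z : ℝ, 0 ≤ z →
      ρ.real {ω | maxNormalizedPower μ (fun m => x m i) (fun m => y m i) ω < z} =
        ∫ r in Ioi (0 : ℝ), outageIntegrand (n + 1) K μ z r := fun z hz =>
    measureReal_maxNormalizedPower_lt hK hμ0 hμ1 hW hlaw hz
  have hmap := map_eq_withDensity_of_measureReal_lt hZ (maxNormalizedPower_nonneg μ _ _)
    (continuous_integral_outageIntegrand n K hμ0 hμ1).continuousOn
    (fun z hz => hasDerivAt_integral_outageIntegrand n K hμ0 hμ1 hz)
    (fun z _ => maxDensity_nonneg n K hμ0 hμ1 z) hcdf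
  -- A pointwise identity, so no measurability of `kstar` is needed.
  have hharvest := fun ω => harvestPower_argmax_eq hμ0 hμ1 hP (fun m => x m i) (fun m => y m i) ω
    (kstar ω) (hkstar ω)
  have hE : avgHarvestedEnergy ρ (α i) T (fun _ => P) μ (fun m => x m i) (fun m => y m i) kstar =
      (1 - α i) * (1 - μ ^ 2) * T * P *
        ∫ ω, maxNormalizedPower μ (fun m => x m i) (fun m => y m i) ω ∂ρ := by
    simp only [avgHarvestedEnergy, hharvest]
    rw [integral_const_mul]
    ring
  have hdm := (aemeasurable_maxDensity n K hμ0 hμ1).ennreal_ofReal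
  have hlt : ∀ᵐ t ∂volume.restrict (Ioi (0 : ℝ)),
      ENNReal.ofReal (maxDensity (n + 1) K μ t) < ⊤ := ae_of_all _ fun _ => ENNReal.ofReal_lt_top
  have hmean : ∫ ω, maxNormalizedPower μ (fun m => x m i) (fun m => y m i) ω ∂ρ =
      ∫ t in Ioi (0 : ℝ), t * maxDensity (n + 1) K μ t := by
    have h := integral_map (f := fun t : ℝ => t) hZ (by fun_prop)
    rw [← h, hmap, integral_withDensity_eq_integral_toReal_smul₀ hdm hlt]
    refine integral_congr_ae (ae_of_all _ fun t => ?_)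
    simp only [ENNReal.toReal_ofReal (maxDensity_nonneg n K hμ0 hμ1 t), smul_eq_mul, mul_comm]
  -- Convergence is transported from the integrability of `Z` through its law, with no estimate of
  -- the double integral.
  have hint : IntegrableOn (fun t : ℝ => t * maxDensity (n + 1) K μ t) (Ioi 0) := by
    have h : Integrable (fun t : ℝ => t)
        (ρ.map (maxNormalizedPower μ (fun m => x m i) (fun m => y m i))) :=
      (integrable_map_measure (by fun_prop) hZ).2 hZint
    rw [hmap, integrable_withDensity_iff_integrable_smul₀' hdm hlt] at h
    refine h.congr (ae_of_all _ fun t => ?_)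
    simp only [ENNReal.toReal_ofReal (maxDensity_nonneg n K hμ0 hμ1 t), smul_eq_mul, mul_comm]
  refine ⟨⟨?_, hZint, hE⟩, fun z hz => ⟨integrableOn_outageIntegrand n K hμ0 hμ1 z, hcdf z hz⟩,
    fun z hz => ⟨fun r hr => hasDerivAt_outageIntegrand n K hμ0 hμ1 hz hr.le,
      integrableOn_densityIntegrand n K hμ0 hμ1 z,
      hasDerivAt_integral_outageIntegrand n K hμ0 hμ1 hz⟩, hmap, hint, ?_, ?_⟩
  · simp only [hharvest]
    exact hZint.const_mul _
  · rw [hE, hmean]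
  · rw [hE, hmean]
    congr 1
    refine integral_congr_ae (ae_of_all _ fun t => ?_)
    simp only [maxDensity, densityIntegrand]
    ring
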